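/- Let $\mathbb K$ be $\mathbb R$ or $\mathbb C$. For normed spaces $X,Y,Z$ and a bounded bilinear map $m:X\times Y\to Z$, define $m^*:Z^*\times X\to Y^*$ by $\langle m^*(z',x),y\rangle=\langle z',m(x,y)\rangle$; iterating this construction gives $m^{**}:Y^{**}\times Z^*\to X^*$ and $m^{***}:X^{**}\times Y^{**}\to Z^{**}$. With $m^t(y,x)=m(x,y)$, the map $m$ is called Arens regular if $m^{***}=m^{t***t}$. A normed algebra is called Arens regular if its multiplication is an Arens regular bilinear map. Let $B$ be a unital Banach algebra over $\mathbb K$, and let $A$ be a normed algebra over $\mathbb K$ (for instance a Banach algebra; not assumed unital) which, as an algebra, is a subalgebra of $B$, that is, there is an injective algebra homomorphism $A\to B$. (The norm of $A$ may be the restriction of the norm of $B$ or another submultiplicative norm, and $A$ need not contain the unit of $B$.) Let $A\hat\otimes B$ be the projective tensor product: the completion of $A\otimes B$ in the norm $\|u\|=\inf\{\sum_i\|a_i\|\,\|b_i\| : u=\sum_i a_i\otimes b_i \text{ (finite sums)}\}$, with the multiplication that extends $(a\otimes b)(a'\otimes b')=aa'\otimes bb'$ continuously. If $A$ is not Arens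 regular, then $A\hat\otimes B$ is not Arens regular. -/

import Mathlib

open scoped TensorProduct

set_option maxSynthPendingDepth 3

noncomputable section

/-! ### Arens regularity -/

section Arens

variable {𝕜 : Type*} [RCLike 𝕜]
  {X : Type*} [NormedAddCommGroup X] [NormedSpace 𝕜 X]
  {Y : Type*} [NormedAddCommGroup Y] [NormedSpace 𝕜 Y]
  {Z : Type*} [NormedAddCommGroup Z] [NormedSpace 𝕜 Z]

/-- The adjoint `m* : Z* × X → Y*` of a bounded bilinear map `m : X × Y → Z`, given by
`⟨m*(z', x), y⟩ = ⟨z', m(x, y)⟩`. -/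
def arensAdjoint (m : X →L[𝕜] Y →L[𝕜] Z) :
    StrongDual 𝕜 Z →L[𝕜] X →L[𝕜] StrongDual 𝕜 Y :=
  ((ContinuousLinearMap.compL 𝕜 X (Y →L[𝕜] Z) (StrongDual 𝕜 Y)).flip m).comp
    (ContinuousLinearMap.compL 𝕜 Y Z 𝕜)

@[simp]
theorem arensAdjoint_apply (m : X →L[𝕜] Y →L[𝕜] Z) (z' : StrongDual 𝕜 Z) (x : X) (y : Y) :
    arensAdjoint m z' x y = z' (m x y) := rfl

/-- The first Arens extension `m*** : X** × Y** → Z**`. -/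
def arensExtension (m : X →L[𝕜] Y →L[𝕜] Z) :
    StrongDual 𝕜 (StrongDual 𝕜 X) →L[𝕜] StrongDual 𝕜 (StrongDual 𝕜 Y) →L[𝕜]
      StrongDual 𝕜 (StrongDual 𝕜 Z) :=
  arensAdjoint (arensAdjoint (arensAdjoint m))

/-- A bounded bilinear map `m` is Arens regular if its two Arens extensions `m***` and `m^{t***t}`
coincide, where `t` denotes the transpose. -/
def IsArensRegularMap (m : X →L[𝕜] Y →L[𝕜] Z) : Prop :=
  arensExtension m = (arensExtension m.flip).flip

end Arens

/-- A normed algebra is Arens regular if its multiplication is an Arens regular bilinear map. -/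
def IsArensRegular (𝕜 : Type*) [RCLike 𝕜] (A : Type*) [NonUnitalNormedRing A] [NormedSpace 𝕜 A]
    [IsScalarTower 𝕜 A A] [SMulCommClass 𝕜 A A] : Prop :=
  IsArensRegularMap (ContinuousLinearMap.mul 𝕜 A)

/-! ### The algebraic tensor product with the projective norm -/

section Projective

variable (𝕜 : Type*) [RCLike 𝕜]
  (A : Type*) [NonUnitalNormedRing A] [NormedSpace 𝕜 A] [IsScalarTower 𝕜 A A] [SMulCommClass 𝕜 A A]
  (B : Type*) [NonUnitalNormedRing B] [NormedSpace 𝕜 B] [IsScalarTower 𝕜 B B] [SMulCommClass 𝕜 B B]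

/-- The algebraic tensor product `A ⊗ B`, as a type of its own that carries the projective norm. -/
def AlgTensor : Type _ := A ⊗[𝕜] B

namespace AlgTensor

/-- The algebra structure with `(a ⊗ b) (a' ⊗ b') = a a' ⊗ b b'`. -/
instance instNonUnitalRing : NonUnitalRing (AlgTensor 𝕜 A B) :=
  inferInstanceAs (NonUnitalRing (A ⊗[𝕜] B))

instance instModule : Module 𝕜 (AlgTensor 𝕜 A B) :=
  inferInstanceAs (Module 𝕜 (A ⊗[𝕜] B))

instance instIsScalarTower : IsScalarTower 𝕜 (AlgTensor 𝕜 A B) (AlgTensor 𝕜 A B) :=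
  inferInstanceAs (IsScalarTower 𝕜 (A ⊗[𝕜] B) (A ⊗[𝕜] B))

instance instSMulCommClass : SMulCommClass 𝕜 (AlgTensor 𝕜 A B) (AlgTensor 𝕜 A B) :=
  inferInstanceAs (SMulCommClass 𝕜 (A ⊗[𝕜] B) (A ⊗[𝕜] B))

variable {A B}

/-- The elementary tensor `a ⊗ b`. -/
def tmul (a : A) (b : B) : AlgTensor 𝕜 A B := a ⊗ₜ[𝕜] b

theorem tmul_mul_tmul (a a' : A) (b b' : B) :
    tmul 𝕜 a b * tmul 𝕜 a' b' = tmul 𝕜 (a * a') (b * b') :=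
  Algebra.TensorProduct.tmul_mul_tmul a a' b b'

theorem smul_tmul (c : 𝕜) (a : A) (b : B) : c • tmul 𝕜 a b = tmul 𝕜 (c • a) b :=
  TensorProduct.smul_tmul' c a b

variable {𝕜}

/-- `∑ aᵢ ⊗ bᵢ` for a finite list of pairs `(aᵢ, bᵢ)`. -/
def listSum (l : List (A × B)) : AlgTensor 𝕜 A B := (l.map fun p => tmul 𝕜 p.1 p.2).sum

/-- `∑ ‖aᵢ‖ ‖bᵢ‖` for a finite list of pairs `(aᵢ, bᵢ)`. -/
def listCost (l : List (A × B)) : ℝ := (l.map fun p => ‖p.1‖ * ‖p.2‖).sum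

/-- The projective norm: `‖u‖ = inf {∑ ‖aᵢ‖ ‖bᵢ‖ : u = ∑ aᵢ ⊗ bᵢ}`. -/
instance instNorm : Norm (AlgTensor 𝕜 A B) :=
  ⟨fun u => sInf {r : ℝ | ∃ l : List (A × B), listSum l = u ∧ listCost l = r}⟩

theorem norm_def (u : AlgTensor 𝕜 A B) :
    ‖u‖ = sInf {r : ℝ | ∃ l : List (A × B), listSum l = u ∧ listCost l = r} := rfl

theorem listCost_nonneg (l : List (A × B)) : 0 ≤ listCost l := by
  refine List.sum_nonneg fun r hr => ?_
  obtain ⟨p, -, rfl⟩ := List.mem_map.1 hr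
  positivity

theorem norm_listSum_le (l : List (A × B)) : ‖(listSum l : AlgTensor 𝕜 A B)‖ ≤ listCost l :=
  csInf_le ⟨0, by rintro _ ⟨l, -, rfl⟩; exact listCost_nonneg l⟩ ⟨l, rfl, rfl⟩

theorem exists_listSum (u : AlgTensor 𝕜 A B) : ∃ l : List (A × B), listSum l = u := by
  refine TensorProduct.induction_on (motive := fun u => ∃ l : List (A × B),
    (listSum l : AlgTensor 𝕜 A B) = u) u ?_ ?_ ?_
  · exact ⟨[], rfl⟩
  · exact fun a b => ⟨[(a, b)], List.sum_singleton⟩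
  · rintro x y ⟨l, rfl⟩ ⟨k, rfl⟩
    exact ⟨l ++ k, by simp only [listSum, List.map_append, List.sum_append]; rfl⟩

theorem exists_listCost_lt (u : AlgTensor 𝕜 A B) {r : ℝ} (h : ‖u‖ < r) :
    ∃ l : List (A × B), listSum l = u ∧ listCost l < r := by
  obtain ⟨l, hl⟩ := exists_listSum u
  rw [norm_def] at h
  have hne : {r : ℝ | ∃ l : List (A × B), listSum l = u ∧ listCost l = r}.Nonempty :=
    ⟨listCost l, l, hl, rfl⟩
  obtain ⟨_, ⟨k, hk, rfl⟩, hlt⟩ := exists_lt_of_csInf_lt hne h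
  exact ⟨k, hk, hlt⟩

theorem norm_nonneg' (u : AlgTensor 𝕜 A B) : 0 ≤ ‖u‖ :=
  Real.sInf_nonneg (by rintro _ ⟨l, -, rfl⟩; exact listCost_nonneg l)

theorem norm_zero' : ‖(0 : AlgTensor 𝕜 A B)‖ = 0 :=
  le_antisymm (by simpa [listSum, listCost] using norm_listSum_le (𝕜 := 𝕜) ([] : List (A × B)))
    (norm_nonneg' _)

theorem norm_add_le' (u v : AlgTensor 𝕜 A B) : ‖u + v‖ ≤ ‖u‖ + ‖v‖ := by
  refine le_of_forall_pos_le_add fun ε hε => ?_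
  obtain ⟨l, rfl, hl⟩ := exists_listCost_lt u (lt_add_of_pos_right ‖u‖ (half_pos hε))
  obtain ⟨k, rfl, hk⟩ := exists_listCost_lt v (lt_add_of_pos_right ‖v‖ (half_pos hε))
  have h := norm_listSum_le (𝕜 := 𝕜) (l ++ k)
  simp only [listSum, listCost, List.map_append, List.sum_append] at h hl hk ⊢
  linarith

theorem norm_smul_le' (c : 𝕜) (u : AlgTensor 𝕜 A B) : ‖c • u‖ ≤ ‖c‖ * ‖u‖ := by
  have key : ∀ l : List (A × B), ‖c • (listSum l : AlgTensor 𝕜 A B)‖ ≤ ‖c‖ * listCost l := by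
    intro l
    have h := norm_listSum_le (𝕜 := 𝕜) (l.map fun p => (c • p.1, p.2))
    simpa [listSum, listCost, List.smul_sum, Function.comp_def, smul_tmul, norm_smul, mul_assoc,
      List.sum_map_mul_left] using h
  refine le_of_forall_pos_le_add fun ε hε => ?_
  have hc : 0 < ‖c‖ + 1 := by positivity
  obtain ⟨l, rfl, hl⟩ := exists_listCost_lt u (lt_add_of_pos_right ‖u‖ (div_pos hε hc))
  refine (key l).trans ?_
  have h1 : ‖c‖ * (ε / (‖c‖ + 1)) ≤ ε := by
    rw [mul_div_assoc', div_le_iff₀ hc]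
    nlinarith
  nlinarith [mul_le_mul_of_nonneg_left hl.le (norm_nonneg c)]

theorem listSum_mul (l k : List (A × B)) :
    (listSum l * listSum k : AlgTensor 𝕜 A B) =
      listSum ((l ×ˢ k).map fun q => (q.1.1 * q.2.1, q.1.2 * q.2.2)) := by
  induction l with
  | nil => simp [listSum]
  | cons p l ih =>
    simp only [listSum, List.map_cons, List.sum_cons, add_mul, List.product_cons, List.map_append,
      List.map_map, List.sum_append] at ih ⊢
    rw [ih, ← List.sum_map_mul_left]
    simp [Function.comp_def, tmul_mul_tmul]

theorem listCost_mul (l k : List (A × B)) :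
    listCost ((l ×ˢ k).map fun q => (q.1.1 * q.2.1, q.1.2 * q.2.2)) ≤ listCost l * listCost k := by
  induction l with
  | nil => simp [listCost]
  | cons p l ih =>
    simp only [listCost, List.map_cons, List.sum_cons, add_mul, List.product_cons, List.map_append,
      List.map_map, List.sum_append] at ih ⊢
    refine add_le_add ?_ ih
    rw [← List.sum_map_mul_left]
    refine List.sum_le_sum fun q _ => ?_
    calc ‖p.1 * q.1‖ * ‖p.2 * q.2‖ ≤ (‖p.1‖ * ‖q.1‖) * (‖p.2‖ * ‖q.2‖) := by
          gcongr <;> exact norm_mul_le _ _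
      _ = ‖p.1‖ * ‖p.2‖ * (‖q.1‖ * ‖q.2‖) := by ring

theorem norm_mul_le' (u v : AlgTensor 𝕜 A B) : ‖u * v‖ ≤ ‖u‖ * ‖v‖ := by
  have hu : ∀ r, ‖u‖ < r → ∀ s, ‖v‖ < s → ‖u * v‖ ≤ r * s := by
    intro r hr s hs
    obtain ⟨l, rfl, hl⟩ := exists_listCost_lt u hr
    obtain ⟨k, rfl, hk⟩ := exists_listCost_lt v hs
    rw [listSum_mul]
    refine (norm_listSum_le _).trans ((listCost_mul l k).trans ?_)
    exact mul_le_mul hl.le hk.le (listCost_nonneg k) ((listCost_nonneg l).trans hl.le)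
  have hlim : Filter.Tendsto (fun t : ℝ => (‖u‖ + t) * (‖v‖ + t)) (nhdsWithin 0 (Set.Ioi 0))
      (nhds (‖u‖ * ‖v‖)) := by
    have : Continuous fun t : ℝ => (‖u‖ + t) * (‖v‖ + t) := by fun_prop
    simpa using (this.tendsto 0).mono_left nhdsWithin_le_nhds
  refine ge_of_tendsto hlim ?_
  filter_upwards [self_mem_nhdsWithin] with t ht
  exact hu _ (lt_add_of_pos_right _ ht) _ (lt_add_of_pos_right _ ht)

/-- The projective norm as a seminorm. -/
def projSeminorm : Seminorm 𝕜 (AlgTensor 𝕜 A B) :=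
  .ofSMulLE norm norm_zero' norm_add_le' norm_smul_le'

instance instSeminormedAddCommGroup : SeminormedAddCommGroup (AlgTensor 𝕜 A B) :=
  fast_instance% AddGroupSeminorm.toSeminormedAddCommGroup
    (projSeminorm (𝕜 := 𝕜) (A := A) (B := B)).toAddGroupSeminorm

instance instNonUnitalSeminormedRing : NonUnitalSeminormedRing (AlgTensor 𝕜 A B) where
  __ := instSeminormedAddCommGroup
  __ := instNonUnitalRing 𝕜 A B
  norm_mul_le := norm_mul_le'

instance instNormedSpace : NormedSpace 𝕜 (AlgTensor 𝕜 A B) where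
  norm_smul_le := norm_smul_le'

end AlgTensor

/-! ### The projective tensor product of Banach algebras -/

/-- The projective tensor product `A ⊗̂ B`: the completion of `A ⊗ B` in the projective norm. -/
def ProjTensor : Type _ := UniformSpace.Completion (AlgTensor 𝕜 A B)

namespace ProjTensor

open UniformSpace UniformSpace.Completion

instance instNormedAddCommGroup : NormedAddCommGroup (ProjTensor 𝕜 A B) :=
  inferInstanceAs (NormedAddCommGroup (Completion (AlgTensor 𝕜 A B)))

instance instNormedSpace : NormedSpace 𝕜 (ProjTensor 𝕜 A B) :=
  inferInstanceAs (NormedSpace 𝕜 (Completion (AlgTensor 𝕜 A B)))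

instance instCompleteSpace : CompleteSpace (ProjTensor 𝕜 A B) :=
  inferInstanceAs (CompleteSpace (Completion (AlgTensor 𝕜 A B)))

variable {𝕜 A B}

/-- The canonical map `A ⊗ B → A ⊗̂ B`. -/
def of (u : AlgTensor 𝕜 A B) : ProjTensor 𝕜 A B := (u : Completion (AlgTensor 𝕜 A B))

theorem isDenseInducing_of : IsDenseInducing (of : AlgTensor 𝕜 A B → ProjTensor 𝕜 A B) :=
  isDenseInducing_coe

theorem continuous_of : Continuous (of : AlgTensor 𝕜 A B → ProjTensor 𝕜 A B) :=
  isDenseInducing_of.continuous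

theorem of_zero : of (0 : AlgTensor 𝕜 A B) = 0 := rfl

theorem of_add (u v : AlgTensor 𝕜 A B) : of (u + v) = of u + of v := coe_add u v

theorem of_smul (c : 𝕜) (u : AlgTensor 𝕜 A B) : of (c • u) = c • of u := coe_smul c u

theorem norm_of (u : AlgTensor 𝕜 A B) : ‖of u‖ = ‖u‖ := norm_coe u

/-- The multiplication of `A ⊗̂ B` is the continuous extension of that of `A ⊗ B`. -/
instance instMul : Mul (ProjTensor 𝕜 A B) :=
  ⟨fun x y => (isDenseInducing_of.prodMap isDenseInducing_of).extend
    (fun p : AlgTensor 𝕜 A B × AlgTensor 𝕜 A B => of (p.1 * p.2)) (x, y)⟩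

theorem of_mul (u v : AlgTensor 𝕜 A B) : of (u * v) = of u * of v :=
  ((isDenseInducing_of.prodMap isDenseInducing_of).extend_eq
    (continuous_of.comp continuous_mul) (u, v)).symm

instance instContinuousMul : ContinuousMul (ProjTensor 𝕜 A B) where
  continuous_mul := by
    let m := (AddMonoidHom.mul : AlgTensor 𝕜 A B →+ AlgTensor 𝕜 A B →+ AlgTensor 𝕜 A B).compr₂
      (toCompl : AlgTensor 𝕜 A B →+ Completion (AlgTensor 𝕜 A B))
    have hm : Continuous fun p : AlgTensor 𝕜 A B × AlgTensor 𝕜 A B => m p.1 p.2 :=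
      (continuous_coe _).comp continuous_mul
    have di : IsDenseInducing
        (toCompl : AlgTensor 𝕜 A B → Completion (AlgTensor 𝕜 A B)) := isDenseInducing_coe
    exact di.extend_Z_bilin di hm

theorem smul_mul (c : 𝕜) (x y : ProjTensor 𝕜 A B) : (c • x) * y = c • (x * y) :=
  isDenseInducing_of.dense.induction_on₂
    (p := fun x y : ProjTensor 𝕜 A B => (c • x) * y = c • (x * y))
    (isClosed_eq ((continuous_fst.const_smul c).mul continuous_snd)
      ((continuous_fst.mul continuous_snd).const_smul c))
    (fun u v => by rw [← of_smul, ← of_mul, ← of_mul, ← of_smul, smul_mul_assoc]) x y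

theorem mul_smul (c : 𝕜) (x y : ProjTensor 𝕜 A B) : x * (c • y) = c • (x * y) :=
  isDenseInducing_of.dense.induction_on₂
    (p := fun x y : ProjTensor 𝕜 A B => x * (c • y) = c • (x * y))
    (isClosed_eq (continuous_fst.mul (continuous_snd.const_smul c))
      ((continuous_fst.mul continuous_snd).const_smul c))
    (fun u v => by rw [← of_smul, ← of_mul, ← of_mul, ← of_smul, mul_smul_comm]) x y

instance instNonUnitalNormedRing : NonUnitalNormedRing (ProjTensor 𝕜 A B) where
  __ := instNormedAddCommGroup 𝕜 A B
  __ := (instMul : Mul (ProjTensor 𝕜 A B))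
  zero_mul x := isDenseInducing_of.dense.induction_on x (isClosed_eq (by fun_prop) (by fun_prop))
    fun u => by rw [← of_zero, ← of_mul, zero_mul]
  mul_zero x := isDenseInducing_of.dense.induction_on x (isClosed_eq (by fun_prop) (by fun_prop))
    fun u => by rw [← of_zero, ← of_mul, mul_zero]
  mul_assoc x y z := isDenseInducing_of.dense.induction_on₃
    (p := fun x y z : ProjTensor 𝕜 A B => x * y * z = x * (y * z))
    (isClosed_eq (by fun_prop) (by fun_prop))
    (fun u v w => by simp only [← of_mul, mul_assoc]) x y z
  left_distrib x y z := isDenseInducing_of.dense.induction_on₃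
    (p := fun x y z : ProjTensor 𝕜 A B => x * (y + z) = x * y + x * z)
    (isClosed_eq (by fun_prop) (by fun_prop))
    (fun u v w => by simp only [← of_mul, ← of_add, mul_add]) x y z
  right_distrib x y z := isDenseInducing_of.dense.induction_on₃
    (p := fun x y z : ProjTensor 𝕜 A B => (x + y) * z = x * z + y * z)
    (isClosed_eq (by fun_prop) (by fun_prop))
    (fun u v w => by simp only [← of_mul, ← of_add, add_mul]) x y z
  norm_mul_le x y := isDenseInducing_of.dense.induction_on₂
    (p := fun x y : ProjTensor 𝕜 A B => ‖x * y‖ ≤ ‖x‖ * ‖y‖)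
    (isClosed_le (by fun_prop) (by fun_prop))
    (fun u v => by simpa only [← of_mul, norm_of] using norm_mul_le u v) x y

instance instIsScalarTower : IsScalarTower 𝕜 (ProjTensor 𝕜 A B) (ProjTensor 𝕜 A B) :=
  ⟨smul_mul⟩

instance instSMulCommClass : SMulCommClass 𝕜 (ProjTensor 𝕜 A B) (ProjTensor 𝕜 A B) :=
  ⟨fun c x y => (mul_smul c x y).symm⟩

end ProjTensor

end Projective

end

/-!
Arens regularity passes from a bounded bilinear map `n : X' × Y' → Z'` to a bounded bilinear map
`m : X × Y → Z` as soon as there are bounded linear maps `i`, `j`, `k` with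
`k (m (x, y)) = n (i x, j y)` such that every bounded functional on `Z` factors through `k`
(`IsArensRegularMap.of_intertwine`). Indeed, both Arens extensions are natural, so `k**` carries the
two extensions of `m` to restrictions of the two extensions of `n`, and `k**` is injective because
`k*` is surjective.

This applies to the multiplications of `A` and `A ⊗̂ B` and the homomorphism `a ↦ a ⊗ 1`, provided
that `1 ≠ 0` in `B`: by Hahn–Banach there is `ψ ∈ B*` with `ψ 1 = 1`, and the functional `f ∈ A*` is
the restriction of `f ⊗ ψ ∈ (A ⊗̂ B)*`. If `1 = 0` in `B`, then `B = 0`, and the injection of `A`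
into `B` forces `A = 0`, which is Arens regular.
-/

noncomputable section

/-! ### Naturality of the Arens extensions -/

section Naturality

variable {𝕜 : Type*} [RCLike 𝕜]
  {X : Type*} [NormedAddCommGroup X] [NormedSpace 𝕜 X]
  {Y : Type*} [NormedAddCommGroup Y] [NormedSpace 𝕜 Y]
  {Z : Type*} [NormedAddCommGroup Z] [NormedSpace 𝕜 Z]
  {X' : Type*} [NormedAddCommGroup X'] [NormedSpace 𝕜 X']
  {Y' : Type*} [NormedAddCommGroup Y'] [NormedSpace 𝕜 Y']
  {Z' : Type*} [NormedAddCommGroup Z'] [NormedSpace 𝕜 Z']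

/-- The transpose `i* : X'* → X*` of a bounded linear map `i : X → X'`. -/
def dualTranspose (i : X →L[𝕜] X') : StrongDual 𝕜 X' →L[𝕜] StrongDual 𝕜 X :=
  (ContinuousLinearMap.compL 𝕜 X X' 𝕜).flip i

/-- Naturality of the first Arens extension: `k** (m*** (F, G)) = n*** (i** F, j** G)`. -/
theorem arensExtension_intertwine {m : X →L[𝕜] Y →L[𝕜] Z} {n : X' →L[𝕜] Y' →L[𝕜] Z'}
    {i : X →L[𝕜] X'} {j : Y →L[𝕜] Y'} {k : Z →L[𝕜] Z'} (h : ∀ x y, k (m x y) = n (i x) (j y))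
    (F : StrongDual 𝕜 (StrongDual 𝕜 X)) (G : StrongDual 𝕜 (StrongDual 𝕜 Y))
    (g : StrongDual 𝕜 Z') :
    arensExtension m F G (g.comp k) =
      arensExtension n (F.comp (dualTranspose i)) (G.comp (dualTranspose j)) g := by
  refine congrArg F (ContinuousLinearMap.ext fun x =>
    congrArg G (ContinuousLinearMap.ext fun y => ?_))
  exact congrArg g (h x y)

theorem IsArensRegularMap.of_intertwine {m : X →L[𝕜] Y →L[𝕜] Z} {n : X' →L[𝕜] Y' →L[𝕜] Z'}
    (hn : IsArensRegularMap n) (i : X →L[𝕜] X') (j : Y →L[𝕜] Y') (k : Z →L[𝕜] Z')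
    (h : ∀ x y, k (m x y) = n (i x) (j y))
    (hk : ∀ f : StrongDual 𝕜 Z, ∃ g : StrongDual 𝕜 Z', g.comp k = f) :
    IsArensRegularMap m := by
  refine ContinuousLinearMap.ext fun F => ContinuousLinearMap.ext fun G =>
    ContinuousLinearMap.ext fun f => ?_
  obtain ⟨g, rfl⟩ := hk f
  have ht : ∀ y x, k (m.flip y x) = n.flip (j y) (i x) := fun y x => h x y
  rw [ContinuousLinearMap.flip_apply, arensExtension_intertwine h,
    arensExtension_intertwine ht, hn, ContinuousLinearMap.flip_apply]

end Naturality

/-! ### Functionals on the projective tensor product -/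

section Functionals

variable {𝕜 : Type*} [RCLike 𝕜]
  {A : Type*} [NonUnitalNormedRing A] [NormedSpace 𝕜 A] [IsScalarTower 𝕜 A A] [SMulCommClass 𝕜 A A]
  {B : Type*} [NonUnitalNormedRing B] [NormedSpace 𝕜 B] [IsScalarTower 𝕜 B B] [SMulCommClass 𝕜 B B]

namespace AlgTensor

/-- The linear functional `f ⊗ ψ : a ⊗ b ↦ f a * ψ b` on the algebraic tensor product. -/
def dualTmulₗ (f : StrongDual 𝕜 A) (ψ : StrongDual 𝕜 B) : AlgTensor 𝕜 A B →ₗ[𝕜] 𝕜 :=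
  TensorProduct.lift ((LinearMap.mul 𝕜 𝕜).compl₁₂ (f : A →ₗ[𝕜] 𝕜) (ψ : B →ₗ[𝕜] 𝕜))

theorem dualTmulₗ_tmul (f : StrongDual 𝕜 A) (ψ : StrongDual 𝕜 B) (a : A) (b : B) :
    dualTmulₗ f ψ (tmul 𝕜 a b) = f a * ψ b :=
  TensorProduct.lift.tmul a b

theorem norm_dualTmulₗ_listSum_le (f : StrongDual 𝕜 A) (ψ : StrongDual 𝕜 B) (l : List (A × B)) :
    ‖dualTmulₗ f ψ (listSum l)‖ ≤ ‖f‖ * ‖ψ‖ * listCost l := by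
  induction l with
  | nil => simp [listSum, listCost]
  | cons p l ih =>
    simp only [listSum, listCost, List.map_cons, List.sum_cons, map_add, mul_add] at ih ⊢
    refine (norm_add_le _ _).trans (add_le_add ?_ ih)
    rw [dualTmulₗ_tmul, norm_mul]
    calc ‖f p.1‖ * ‖ψ p.2‖ ≤ (‖f‖ * ‖p.1‖) * (‖ψ‖ * ‖p.2‖) := by
          gcongr <;> exact ContinuousLinearMap.le_opNorm _ _
      _ = ‖f‖ * ‖ψ‖ * (‖p.1‖ * ‖p.2‖) := by ring

theorem norm_dualTmulₗ_le (f : StrongDual 𝕜 A) (ψ : StrongDual 𝕜 B) (u : AlgTensor 𝕜 A B) :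
    ‖dualTmulₗ f ψ u‖ ≤ ‖f‖ * ‖ψ‖ * ‖u‖ := by
  obtain ⟨l₀, hl₀⟩ := exists_listSum u
  rw [norm_def, ← smul_eq_mul (‖f‖ * ‖ψ‖), ← Real.sInf_smul_of_nonneg (by positivity)]
  refine le_csInf (Set.Nonempty.smul_set ⟨_, l₀, hl₀, rfl⟩) ?_
  rintro _ ⟨_, ⟨l, rfl, rfl⟩, rfl⟩
  exact norm_dualTmulₗ_listSum_le f ψ l

end AlgTensor

namespace ProjTensor

/-- The canonical map `A ⊗ B → A ⊗̂ B` as a bounded linear map. -/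
def ofL : AlgTensor 𝕜 A B →L[𝕜] ProjTensor 𝕜 A B where
  toFun := of
  map_add' := of_add
  map_smul' := of_smul
  cont := continuous_of

/-- The bounded functional `f ⊗ ψ` on the projective tensor product. -/
def dualTmul (f : StrongDual 𝕜 A) (ψ : StrongDual 𝕜 B) : StrongDual 𝕜 (ProjTensor 𝕜 A B) :=
  ((AlgTensor.dualTmulₗ f ψ).mkContinuous (‖f‖ * ‖ψ‖) (AlgTensor.norm_dualTmulₗ_le f ψ)).extend ofL

theorem dualTmul_of_tmul (f : StrongDual 𝕜 A) (ψ : StrongDual 𝕜 B) (a : A) (b : B) :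
    dualTmul f ψ (of (AlgTensor.tmul 𝕜 a b)) = f a * ψ b :=
  (ContinuousLinearMap.extend_eq _ isDenseInducing_of.dense
    (UniformSpace.Completion.isUniformInducing_coe _) _).trans (AlgTensor.dualTmulₗ_tmul f ψ a b)

/-- The bounded linear map `A → A ⊗̂ B`, `a ↦ a ⊗ b`. -/
def tmulRight (b : B) : A →L[𝕜] ProjTensor 𝕜 A B :=
  LinearMap.mkContinuous
    { toFun := fun a => of (AlgTensor.tmul 𝕜 a b)
      map_add' := fun a a' => (congrArg of (TensorProduct.add_tmul a a' b)).trans (of_add _ _)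
      map_smul' := fun c a => by
        rw [← AlgTensor.smul_tmul, of_smul, RingHom.id_apply] }
    ‖b‖ fun a => by
      have h := AlgTensor.norm_listSum_le (𝕜 := 𝕜) [(a, b)]
      rw [mul_comm]
      simp only [AlgTensor.listSum, AlgTensor.listCost, List.map_cons, List.map_nil,
        List.sum_singleton] at h
      exact (norm_of _).trans_le h

theorem tmulRight_apply (b : B) (a : A) :
    tmulRight (𝕜 := 𝕜) b a = of (AlgTensor.tmul 𝕜 a b) := rfl

/-- A nonzero idempotent `e` of `B` makes `a ↦ a ⊗ e` a homomorphism along which every bounded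
functional on `A` extends to `A ⊗̂ B`. -/
theorem isArensRegular_left_of_idempotent {e : B} (he : e * e = e) (he0 : e ≠ 0)
    (h : IsArensRegular 𝕜 (ProjTensor 𝕜 A B)) : IsArensRegular 𝕜 A := by
  obtain ⟨ψ, hψ⟩ := SeparatingDual.exists_eq_one (R := 𝕜) he0
  refine IsArensRegularMap.of_intertwine h (tmulRight e) (tmulRight e) (tmulRight e) ?_ ?_
  · intro a a'
    simp only [ContinuousLinearMap.mul_apply', tmulRight_apply, ← of_mul, AlgTensor.tmul_mul_tmul,
      he]
  · refine fun f => ⟨dualTmul f ψ, ContinuousLinearMap.ext fun a => ?_⟩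
    rw [ContinuousLinearMap.comp_apply, tmulRight_apply, dualTmul_of_tmul, hψ, mul_one]

end ProjTensor

end Functionals

/-- If `A = 0` then `A** = 0`, and both Arens products vanish. -/
theorem IsArensRegular.of_subsingleton {𝕜 : Type*} [RCLike 𝕜] {A : Type*} [NonUnitalNormedRing A]
    [NormedSpace 𝕜 A] [IsScalarTower 𝕜 A A] [SMulCommClass 𝕜 A A] [Subsingleton A] :
    IsArensRegular 𝕜 A :=
  Subsingleton.elim _ _

end

theorem mainTheorem8 {𝕜 : Type*} [RCLike 𝕜]
    {B : Type*} [NormedRing B] [NormedAlgebra 𝕜 B] [CompleteSpace B]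
    {A : Type*} [NonUnitalNormedRing A] [NormedSpace 𝕜 A]
    [IsScalarTower 𝕜 A A] [SMulCommClass 𝕜 A A]
    (T : A →ₙₐ[𝕜] B) (hT : Function.Injective T)
    (hA : ¬ IsArensRegular 𝕜 A) :
    ¬ IsArensRegular 𝕜 (ProjTensor 𝕜 A B) := by
  intro h
  rcases subsingleton_or_nontrivial B with hB | hB
  · have : Subsingleton A := hT.subsingleton
    exact hA IsArensRegular.of_subsingleton
  · exact hA (ProjTensor.isArensRegular_left_of_idempotent (one_mul (1 : B)) one_ne_zero h)
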